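/- Let $n>0$ be an integer. For $b=(b_1,\ldots,b_n)\in\mathbf{R}^n$ let $$g_b=(x^{2n}+1)+b_1(x^{2n-1}+x)+\cdots+b_{n-1}(x^{n+1}+x^{n-1})+b_nx^n,$$ and let $V_n\subset\mathbf{R}^n$ be the set of those $b$ such that all complex roots of $g_b$ lie on the unit circle. Let $$c_1=\frac{\sqrt3}{6},\qquad c_2=\frac{2\,e^{3/2}(1+\sqrt2)\sqrt3\,\bigl(1+\sqrt3/162\bigr)^3}{3},\qquad c_3=\frac{c_2}{1+\sqrt2}.$$ Let $\Lambda\subset\mathbf{R}^n$ be a rectilinear lattice, that is, a lattice that has a fundamental domain $R$ which is a box $\prod_{i=1}^n[p_i,q_i)$ with $p_i<q_i$ (edges parallel to the coordinate axes). Let $d=\max_i(q_i-p_i)$ be its mesh, the length of the longest edge of $R$, and suppose that $d\le 1$. Then $\Lambda\cap V_n$ is finite, $V_n$ has finite volume, and $$\left|\#(\Lambda\cap V_n)-\frac{\operatorname{vol}V_n}{\operatorname{covol}\Lambda}\right|\le 6^{n^2}c_1^nc_3\,\frac{n(n+1)}{(n-1)!}\cdot\frac{d}{\operatorname{covol}\Lambda},$$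 where $\operatorname{covol}\Lambda$ is the volume of a fundamental domain of $\Lambda$. -/

import Mathlib

namespace UnitCirclePoly

open Polynomial MeasureTheory

/-- For `b = (b₁, …, bₙ)` (with `b i` standing for the entry `b_{i+1}`), the polynomial
`(x^{2n} + 1) + b₁ (x^{2n-1} + x) + ⋯ + b_{n-1} (x^{n+1} + x^{n-1}) + bₙ x^n`. -/
noncomputable def gPoly (n : ℕ) (b : Fin n → ℝ) : ℝ[X] :=
  (X ^ (2 * n) + 1) +
    ∑ i : Fin n, C (b i) *
      (if (i : ℕ) + 1 = n then X ^ n else X ^ (2 * n - (i + 1)) + X ^ ((i : ℕ) + 1))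

/-- The set `V_n` of those `b ∈ ℝⁿ` such that all complex roots of `gPoly n b` lie on the
unit circle. -/
def V (n : ℕ) : Set (Fin n → ℝ) :=
  {b | ∀ z : ℂ, aeval z (gPoly n b) = 0 → ‖z‖ = 1}

/-- The box `∏ᵢ [pᵢ, qᵢ)`, with edges parallel to the coordinate axes. -/
def box {n : ℕ} (p q : Fin n → ℝ) : Set (Fin n → ℝ) :=
  Set.univ.pi fun i => Set.Ico (p i) (q i)

/-- The (nondegenerate) box `∏ᵢ [pᵢ, qᵢ)` is a fundamental domain of `Λ`. A lattice is
rectilinear if it has such a fundamental domain. -/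
structure IsRectilinearDomain {n : ℕ} (Λ : Submodule ℤ (Fin n → ℝ)) (p q : Fin n → ℝ) :
    Prop where
  lt : ∀ i, p i < q i
  isAddFundamentalDomain : IsAddFundamentalDomain Λ (box p q) volume

/-- The length of the longest edge of the box `∏ᵢ [pᵢ, qᵢ)`. -/
noncomputable def mesh {n : ℕ} (p q : Fin n → ℝ) : ℝ := ⨆ i, (q i - p i)

noncomputable def c₁ : ℝ := √3 / 6

noncomputable def c₂ : ℝ :=
  Real.exp (3 / 2) * 2 * (1 + √2) * √3 * (1 + √3 / 162) ^ 3 / 3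

noncomputable def c₃ : ℝ := c₂ / (1 + √2)

end UnitCirclePoly

/-!
Since `g_b` is palindromic, `g_b(z) = zⁿ f(z + 1/z)` for a monic real polynomial `f` of degree `n`,
and `b ∈ V_n` exactly when all roots of `f` are real and lie in `[-2, 2]`. Hence `V_n` is the image
of the cube `[-2, 2]ⁿ` under the polynomial map that sends a tuple of roots to `b`. Real roots that
are distinct and interior persist under perturbation of `b`, so at a frontier point of `V_n` either
`±2` is a root or two roots coincide: the frontier lies in Lipschitz images of three cubes of
dimension `n - 1`. Covering these cubes by small ones bounds the volume of the `d`-neighbourhood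
of the frontier by a multiple of `d`. Up to a null set, that neighbourhood contains every point at
which `V_n` and the union of the lattice boxes with corners in `Λ ∩ V_n` differ.
-/

namespace UnitCirclePoly

open Filter Lagrange Metric MeasureTheory Polynomial Topology
open scoped NNReal Pointwise

theorem natDegree_chebyshev_C (n : ℕ) : (Chebyshev.C ℝ n).natDegree = n := by
  have h := congrArg natDegree (Chebyshev.C_comp_two_mul_X ℝ n)
  rwa [natDegree_comp, ← C_ofNat, natDegree_C_mul_X _ two_ne_zero, mul_one,
    natDegree_C_mul two_ne_zero, Chebyshev.natDegree_T, Int.natAbs_natCast] at h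

theorem monic_chebyshev_C {n : ℕ} (hn : n ≠ 0) : (Chebyshev.C ℝ n).Monic := by
  have h := congrArg leadingCoeff (Chebyshev.C_comp_two_mul_X ℝ n)
  have hX : (C 2 * X : ℝ[X]).natDegree ≠ 0 := by simp
  rw [← C_ofNat, leadingCoeff_comp hX, leadingCoeff_mul_X, leadingCoeff_mul, leadingCoeff_C,
    natDegree_chebyshev_C, Chebyshev.leadingCoeff_T, Int.natAbs_natCast,
    mul_pow_sub_one hn] at h
  exact mul_right_cancel₀ (pow_ne_zero n two_ne_zero) (h.trans (one_mul _).symm)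

theorem eval_chebyshev_C_add_inv {K : Type*} [Field K] {z : K} (hz : z ≠ 0) (n : ℕ) :
    (Chebyshev.C K n).eval (z + z⁻¹) = z ^ n + z⁻¹ ^ n := by
  rw [← dickson_one_one_eq_chebyshev_C, dickson_one_one_eval_add_inv _ _ (mul_inv_cancel₀ hz)]

/-- The trace polynomial of `gPoly n b`: the monic real polynomial `f` of degree `n` such that
`gPoly n b` is `z ^ n * f (z + 1 / z)`. Pairs `z, 1 / z` of roots of `gPoly n b` on the unit circle
correspond to roots of `f` in `[-2, 2]`. -/
noncomputable def tracePoly (n : ℕ) (b : Fin n → ℝ) : ℝ[X] :=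
  Chebyshev.C ℝ n +
    ∑ i : Fin n, C (b i) * (if (i : ℕ) + 1 = n then 1 else Chebyshev.C ℝ (n - (i + 1) : ℕ))

theorem degree_tracePoly_sub_chebyshev_C_lt (n : ℕ) (b : Fin n → ℝ) :
    (tracePoly n b - Chebyshev.C ℝ n).degree < n := by
  rw [tracePoly, add_sub_cancel_left, ← mem_degreeLT]
  refine Submodule.sum_mem _ fun i _ => ?_
  rw [← smul_eq_C_mul]
  refine Submodule.smul_mem _ _ (mem_degreeLT.2 ?_)
  have hi := i.isLt
  refine degree_le_natDegree.trans_lt (Nat.cast_lt.2 ?_)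
  split_ifs
  · rw [natDegree_one]
    lia
  · rw [natDegree_chebyshev_C]
    lia

theorem monic_tracePoly {n : ℕ} (hn : n ≠ 0) (b : Fin n → ℝ) : (tracePoly n b).Monic := by
  rw [← add_sub_cancel (Chebyshev.C ℝ n) (tracePoly n b)]
  refine (monic_chebyshev_C hn).add_of_left ?_
  rw [degree_eq_natDegree (monic_chebyshev_C hn).ne_zero, natDegree_chebyshev_C]
  exact degree_tracePoly_sub_chebyshev_C_lt n b

theorem natDegree_tracePoly {n : ℕ} (hn : n ≠ 0) (b : Fin n → ℝ) :
    (tracePoly n b).natDegree = n := by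
  have h : (Chebyshev.C ℝ n).degree = n := by
    rw [degree_eq_natDegree (monic_chebyshev_C hn).ne_zero, natDegree_chebyshev_C]
  rw [← add_sub_cancel (Chebyshev.C ℝ n) (tracePoly n b)]
  refine natDegree_eq_of_degree_eq_some ?_
  rw [degree_add_eq_left_of_degree_lt (h ▸ degree_tracePoly_sub_chebyshev_C_lt n b), h]

theorem continuous_eval_tracePoly (n : ℕ) (x : ℝ) :
    Continuous fun b : Fin n → ℝ => (tracePoly n b).eval x := by
  simp only [tracePoly, eval_add, eval_finsetSum, eval_mul, eval_C]
  fun_prop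

theorem aeval_gPoly {K : Type*} [Field K] [Algebra ℝ K] (n : ℕ) (b : Fin n → ℝ) {z : K}
    (hz : z ≠ 0) : aeval z (gPoly n b) = z ^ n * aeval (z + z⁻¹) (tracePoly n b) := by
  have key {k : ℕ} (hk : k ≤ n) : z ^ n * (z ^ k + z⁻¹ ^ k) = z ^ (n + k) + z ^ (n - k) := by
    rw [mul_add, ← pow_add, inv_pow, pow_sub₀ z hz hk]
  simp only [gPoly, tracePoly, map_add, map_sum, map_mul, map_pow, aeval_X, aeval_C, map_one,
    Chebyshev.aeval_C, eval_chebyshev_C_add_inv hz, mul_add (z ^ n) (_ + _), key le_rfl,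
    Finset.mul_sum]
  congr 1
  · rw [two_mul, Nat.sub_self, pow_zero]
  refine Finset.sum_congr rfl fun i _ => ?_
  rw [mul_left_comm]
  congr 1
  split_ifs
  · rw [map_pow, aeval_X, map_one, mul_one]
  · simp only [map_add, map_pow, aeval_X, Chebyshev.aeval_C, eval_chebyshev_C_add_inv hz]
    rw [key (Nat.sub_le _ _)]
    congr 2 <;> lia

theorem exists_add_inv_eq {K : Type*} [Field K] [IsAlgClosed K] (w : K) :
    ∃ z : K, z ≠ 0 ∧ z + z⁻¹ = w := by
  have hdeg : (X ^ 2 - C w * X + 1 : K[X]).degree = 2 := by compute_degree!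
  obtain ⟨z, hz⟩ := IsAlgClosed.exists_root (X ^ 2 - C w * X + 1 : K[X]) (by simp [hdeg])
  have h : z ^ 2 - w * z + 1 = 0 := by simpa using hz
  have hz0 : z ≠ 0 := by
    rintro rfl
    simp at h
  refine ⟨z, hz0, ?_⟩
  field_simp
  linear_combination h

theorem norm_eq_one_of_sq_sub_mul_add_one_eq_zero {z : ℂ} {a : ℝ} (ha : |a| ≤ 2)
    (h : z ^ 2 - a * z + 1 = 0) : ‖z‖ = 1 := by
  obtain ⟨θ, rfl⟩ : ∃ θ : ℝ, 2 * Real.cos θ = a := by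
    refine ⟨Real.arccos (a / 2), ?_⟩
    have := abs_le.1 ha
    rw [Real.cos_arccos (by linarith) (by linarith), mul_div_cancel₀ a two_ne_zero]
  have hfactor :
      (z - Complex.exp (θ * Complex.I)) * (z - Complex.exp ((-θ : ℝ) * Complex.I)) = 0 := by
    have hcos := Complex.two_cos θ
    have hexp : Complex.exp (θ * Complex.I) * Complex.exp (-θ * Complex.I) = 1 := by
      rw [← Complex.exp_add, neg_mul, add_neg_cancel, Complex.exp_zero]
    push_cast at h ⊢
    linear_combination h + z * hcos + hexp
  rcases mul_eq_zero.1 hfactor with h | h <;>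
    rw [sub_eq_zero.1 h, Complex.norm_exp_ofReal_mul_I]

theorem exists_eq_nodal_of_aeval_eq_zero {K L ι : Type*} [Field K] [Field L] [IsAlgClosed L]
    [Algebra K L] [Fintype ι] {f : K[X]} (hf : f.Monic) (hdeg : f.natDegree = Fintype.card ι)
    {s : Set K} (hs : ∀ w : L, aeval w f = 0 → ∃ a ∈ s, algebraMap K L a = w) :
    ∃ y : ι → K, (∀ k, y k ∈ s) ∧ f = nodal Finset.univ y := by
  classical
  have hsplits : f.Splits := by
    refine Splits.of_splits_map (algebraMap K L) (IsAlgClosed.splits _) fun w hw => ?_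
    rw [mem_roots (hf.map _).ne_zero, IsRoot, eval_map_algebraMap] at hw
    obtain ⟨a, -, rfl⟩ := hs w hw
    exact ⟨a, rfl⟩
  let e : ι ≃ f.roots := Fintype.equivOfCardEq <| by
    rw [Multiset.card_coe, ← hsplits.natDegree_eq_card_roots, hdeg]
  refine ⟨fun k => (e k).1, fun k => ?_, ?_⟩
  · have hroot : f.eval (e k).1 = 0 := (mem_roots'.1 (Multiset.coe_mem (x := e k))).2
    obtain ⟨a, ha, hak⟩ := hs (algebraMap K L (e k).1) <| by
      rw [aeval_algebraMap_apply, coe_aeval_eq_eval, hroot, map_zero]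
    exact Set.mem_of_eq_of_mem ((algebraMap K L).injective hak).symm ha
  · rw [nodal, e.prod_comp fun x : f.roots => X - C x.1, Finset.prod_eq_multiset_prod,
      Multiset.map_univ f.roots fun a => X - C a]
    exact hsplits.eq_prod_roots_of_monic hf

theorem exists_tracePoly_eq_nodal {n : ℕ} (hn : n ≠ 0) {b : Fin n → ℝ} (hb : b ∈ V n) :
    ∃ y ∈ closedBall (0 : Fin n → ℝ) 2, tracePoly n b = nodal Finset.univ y := by
  obtain ⟨y, hy, h⟩ := exists_eq_nodal_of_aeval_eq_zero (L := ℂ) (ι := Fin n)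
    (s := closedBall 0 2) (monic_tracePoly hn b) (by simp [natDegree_tracePoly hn]) fun w hw => by
      obtain ⟨z, hz, rfl⟩ := exists_add_inv_eq w
      have hnorm : ‖z‖ = 1 := hb z (by rw [aeval_gPoly n b hz, hw, mul_zero])
      refine ⟨2 * z.re, ?_, ?_⟩
      · have := Complex.abs_re_le_norm z
        rw [mem_closedBall_zero_iff, norm_mul, Real.norm_ofNat, Real.norm_eq_abs]
        linarith
      · rw [Complex.inv_eq_conj hnorm, Complex.add_conj, Complex.coe_algebraMap]
  refine ⟨y, ?_, h⟩
  rw [closedBall_pi _ zero_le_two]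
  exact fun k _ => hy k

/-- The self-reciprocal quadratic polynomial whose roots `z, 1 / z` satisfy `z + 1 / z = a`. -/
noncomputable def reciprocalQuadratic (a : ℝ) : ℝ[X] := X ^ 2 - C a * X + 1

theorem natDegree_prod_reciprocalQuadratic_le {ι : Type*} [Fintype ι] (y : ι → ℝ) :
    (∏ k, reciprocalQuadratic (y k)).natDegree ≤ 2 * Fintype.card ι := by
  refine (natDegree_prod_le _ _).trans ((Finset.sum_le_card_nsmul _ _ 2 fun k _ => ?_).trans ?_)
  · change (X ^ 2 - C (y k) * X + 1 : ℝ[X]).natDegree ≤ 2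
    compute_degree
  · rw [Finset.card_univ, smul_eq_mul, mul_comm]

theorem eval_reciprocalQuadratic (a x : ℝ) :
    (reciprocalQuadratic a).eval x = x ^ 2 - a * x + 1 := by
  simp [reciprocalQuadratic]

/-- The coordinates of the point of `V n` whose polynomial has the roots `z` with
`z + 1 / z = y k`, read off from `∏ k, (X ^ 2 - y k * X + 1)`. -/
noncomputable def coeffMap (n : ℕ) (y : Fin n → ℝ) (i : Fin n) : ℝ :=
  (∏ k, reciprocalQuadratic (y k)).coeff (i + 1)

theorem coeffMap_comp_perm {n : ℕ} (y : Fin n → ℝ) (σ : Equiv.Perm (Fin n)) :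
    coeffMap n (y ∘ σ) = coeffMap n y := by
  funext i
  exact congrArg (coeff · _) (Equiv.prod_comp σ fun k => reciprocalQuadratic (y k))

theorem coeff_palindromic_monomial {n k : ℕ} (hk : k ≤ n) (i : Fin n) :
    (if (i : ℕ) + 1 = n then X ^ n else X ^ (2 * n - (i + 1)) + X ^ ((i : ℕ) + 1) : ℝ[X]).coeff k =
      if k = i + 1 then 1 else 0 := by
  have hi := i.isLt
  by_cases hin : (i : ℕ) + 1 = n
  · rw [if_pos hin, coeff_X_pow, hin]
  · rw [if_neg hin, coeff_add, coeff_X_pow, coeff_X_pow, if_neg (by lia), zero_add]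

theorem coeff_zero_gPoly {n : ℕ} (hn : n ≠ 0) (b : Fin n → ℝ) : (gPoly n b).coeff 0 = 1 := by
  simp only [gPoly, coeff_add, finsetSum_coeff, coeff_C_mul, coeff_palindromic_monomial n.zero_le]
  simp [hn]

theorem coeff_succ_gPoly {n : ℕ} (b : Fin n → ℝ) (i : Fin n) :
    (gPoly n b).coeff (i + 1) = b i := by
  have hi : (i : ℕ) + 1 ≠ 2 * n := by lia
  simp only [gPoly, coeff_add, finsetSum_coeff, coeff_C_mul, coeff_palindromic_monomial i.isLt]
  simp [coeff_X_pow, coeff_one, hi, Fin.val_inj]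

theorem natDegree_gPoly_le (n : ℕ) (b : Fin n → ℝ) : (gPoly n b).natDegree ≤ 2 * n := by
  refine natDegree_add_le_of_degree_le (by compute_degree!) ?_
  refine natDegree_sum_le_of_forall_le _ _ fun i _ => (natDegree_C_mul_le _ _).trans ?_
  have hi := i.isLt
  split_ifs <;> compute_degree <;> lia

theorem gPoly_eq_prod {n : ℕ} {b y : Fin n → ℝ} (h : tracePoly n b = nodal Finset.univ y) :
    gPoly n b = ∏ k, reciprocalQuadratic (y k) := by
  refine eq_of_infinite_eval_eq _ _ ((Set.finite_singleton (0 : ℝ)).infinite_compl.mono ?_)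
  intro x (hx : x ≠ 0)
  have hg := aeval_gPoly n b hx
  simp only [coe_aeval_eq_eval, h, eval_nodal] at hg
  change eval x (gPoly n b) = _
  rw [hg, eval_prod, ← Fin.prod_const, ← Finset.prod_mul_distrib]
  refine Finset.prod_congr rfl fun k _ => ?_
  rw [eval_reciprocalQuadratic]
  linear_combination mul_inv_cancel₀ hx

theorem eq_coeffMap {n : ℕ} {b y : Fin n → ℝ} (h : tracePoly n b = nodal Finset.univ y) :
    b = coeffMap n y := by
  funext i
  rw [coeffMap, ← gPoly_eq_prod h, coeff_succ_gPoly]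

theorem reflect_eq_self {K : Type*} [Field K] [Infinite K] {N : ℕ} {p : K[X]}
    (hp : p.natDegree ≤ N) (h : ∀ x ≠ 0, x ^ N * p.eval x⁻¹ = p.eval x) : reflect N p = p := by
  refine eq_of_infinite_eval_eq _ _ ((Set.finite_singleton (0 : K)).infinite_compl.mono ?_)
  intro x (hx : x ≠ 0)
  let := invertibleOfNonzero (inv_ne_zero hx)
  have hreflect := eval₂_reflect_mul_pow (RingHom.id K) x⁻¹ N p hp
  rw [invOf_eq_inv, inv_inv, ← eval, ← eval] at hreflect
  change eval x _ = eval x p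
  rw [← h x hx, ← hreflect, inv_pow]
  field_simp

theorem eq_of_reflect_eq_self {R : Type*} [Semiring R] {n : ℕ} {p q : R[X]}
    (hp : reflect (2 * n) p = p) (hq : reflect (2 * n) q = q) (hpn : p.natDegree ≤ 2 * n)
    (hqn : q.natDegree ≤ 2 * n) (h : ∀ j ≤ n, p.coeff j = q.coeff j) : p = q := by
  refine (ext_iff_natDegree_le hpn hqn).2 fun j hj => ?_
  rcases le_total j n with hjn | hjn
  · exact h j hjn
  · rw [← hp, ← hq, coeff_reflect, coeff_reflect, revAt_le hj]
    exact h _ (by lia)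

theorem reflect_gPoly (n : ℕ) (b : Fin n → ℝ) : reflect (2 * n) (gPoly n b) = gPoly n b := by
  refine reflect_eq_self (natDegree_gPoly_le n b) fun x hx => ?_
  have h := aeval_gPoly n b (inv_ne_zero hx)
  have h' := aeval_gPoly n b hx
  simp only [coe_aeval_eq_eval] at h h'
  rw [h, h', inv_inv, add_comm x⁻¹ x, ← mul_assoc, two_mul, pow_add, mul_assoc (x ^ n), ← mul_pow,
    mul_inv_cancel₀ hx, one_pow, mul_one]

theorem reflect_prod_reciprocalQuadratic {n : ℕ} (y : Fin n → ℝ) :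
    reflect (2 * n) (∏ k, reciprocalQuadratic (y k)) = ∏ k, reciprocalQuadratic (y k) := by
  refine reflect_eq_self (by simpa using natDegree_prod_reciprocalQuadratic_le y) fun x hx => ?_
  rw [pow_mul, eval_prod, eval_prod, ← Fin.prod_const, ← Finset.prod_mul_distrib]
  refine Finset.prod_congr rfl fun k _ => ?_
  rw [eval_reciprocalQuadratic, eval_reciprocalQuadratic]
  field_simp
  ring

theorem gPoly_coeffMap {n : ℕ} (hn : n ≠ 0) (y : Fin n → ℝ) :
    gPoly n (coeffMap n y) = ∏ k, reciprocalQuadratic (y k) := by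
  refine eq_of_reflect_eq_self (reflect_gPoly n _) (reflect_prod_reciprocalQuadratic y)
    (natDegree_gPoly_le n _) (by simpa using natDegree_prod_reciprocalQuadratic_le y) ?_
  rintro (_ | j) hj
  · rw [coeff_zero_gPoly hn, coeff_zero_eq_eval_zero, eval_prod]
    simp [eval_reciprocalQuadratic]
  · exact coeff_succ_gPoly _ ⟨j, hj⟩

theorem coeffMap_mem_V {n : ℕ} (hn : n ≠ 0) {y : Fin n → ℝ} (hy : y ∈ closedBall 0 2) :
    coeffMap n y ∈ V n := by
  intro z hz
  rw [gPoly_coeffMap hn, map_prod, Finset.prod_eq_zero_iff] at hz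
  obtain ⟨k, -, hk⟩ := hz
  refine norm_eq_one_of_sq_sub_mul_add_one_eq_zero (a := y k) ?_ (by
    simpa [reciprocalQuadratic] using hk)
  exact (norm_le_pi_norm y k).trans (mem_closedBall_zero_iff.1 hy)

theorem V_eq_image {n : ℕ} (hn : n ≠ 0) : V n = coeffMap n '' closedBall 0 2 := by
  refine Set.Subset.antisymm (fun b hb => ?_) (Set.image_subset_iff.2 fun y => coeffMap_mem_V hn)
  obtain ⟨y, hy, h⟩ := exists_tracePoly_eq_nodal hn hb
  exact ⟨y, hy, (eq_coeffMap h).symm⟩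

/-- Coefficientwise domination: `P` has nonnegative coefficients which bound the absolute values of
those of `p`. -/
def Dominated {R : Type*} [Ring R] [LinearOrder R] (p P : R[X]) : Prop :=
  ∀ j, |p.coeff j| ≤ P.coeff j

section Dominated

variable {R : Type*} [CommRing R] [LinearOrder R] [IsStrictOrderedRing R]

theorem Dominated.add {p q P Q : R[X]} (hp : Dominated p P) (hq : Dominated q Q) :
    Dominated (p + q) (P + Q) := fun j => by
  rw [coeff_add, coeff_add]
  exact (abs_add_le _ _).trans (add_le_add (hp j) (hq j))

theorem Dominated.mul {p q P Q : R[X]} (hp : Dominated p P) (hq : Dominated q Q) :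
    Dominated (p * q) (P * Q) := fun j => by
  rw [coeff_mul, coeff_mul]
  refine (Finset.abs_sum_le_sum_abs _ _).trans (Finset.sum_le_sum fun x _ => ?_)
  rw [abs_mul]
  exact mul_le_mul (hp _) (hq _) (abs_nonneg _) ((abs_nonneg _).trans (hp _))

theorem Dominated.prod {ι : Type*} {p P : ι → R[X]} (s : Finset ι)
    (h : ∀ k, Dominated (p k) (P k)) : Dominated (∏ k ∈ s, p k) (∏ k ∈ s, P k) :=
  Finset.prod_hom_rel (fun j => by rw [coeff_one]; split_ifs <;> simp) fun k _ _ => (h k).mul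

theorem Dominated.prod_sub_prod {ι : Type*} {p q P : ι → R[X]} {δ : R} (s : Finset ι)
    (hp : ∀ k, Dominated (p k) (P k)) (hq : ∀ k, Dominated (q k) (P k))
    (hpq : ∀ k, Dominated (p k - q k) (C δ * P k)) :
    Dominated (∏ k ∈ s, p k - ∏ k ∈ s, q k) (C (s.card * δ) * ∏ k ∈ s, P k) := by
  classical
  induction s using Finset.induction_on with
  | empty => simp [Dominated]
  | insert a s ha ih =>
    have htelescope := ((hpq a).mul (Dominated.prod s hp)).add ((hq a).mul ih)
    rw [Finset.prod_insert ha, Finset.prod_insert ha, Finset.prod_insert ha,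
      Finset.card_insert_of_notMem ha]
    convert htelescope using 1
    · ring
    · simp only [Nat.cast_add, Nat.cast_one, C_mul, C_add, C_1]
      ring

end Dominated

theorem dominated_reciprocalQuadratic {a : ℝ} (ha : |a| ≤ 2) :
    Dominated (reciprocalQuadratic a) ((1 + X) ^ 2) := by
  rintro (_ | _ | _ | j) <;>
    simp [reciprocalQuadratic, coeff_one_add_X_pow, coeff_X, coeff_one, Nat.choose_eq_zero_of_lt,
      ha]

theorem dominated_reciprocalQuadratic_sub (a a' : ℝ) :
    Dominated (reciprocalQuadratic a - reciprocalQuadratic a')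
      (C (|a - a'| / 2) * (1 + X) ^ 2) := by
  have heq : reciprocalQuadratic a - reciprocalQuadratic a' = C (a' - a) * X := by
    simp only [reciprocalQuadratic, C_sub]
    ring
  rintro (_ | _ | j) <;> rw [heq, coeff_C_mul, coeff_C_mul, coeff_one_add_X_pow]
  · rw [coeff_X_zero, mul_zero, abs_zero]
    positivity
  · simp [abs_sub_comm]
  · rw [coeff_X_of_ne_one (by lia), mul_zero, abs_zero]
    positivity

theorem lipschitzOnWith_coeffMap (n : ℕ) :
    LipschitzOnWith (n * n.centralBinom / 2) (coeffMap n) (closedBall 0 2) := by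
  refine LipschitzOnWith.of_dist_le_mul fun y hy y' hy' => ?_
  have hbound {x : Fin n → ℝ} (hx : x ∈ closedBall 0 2) (k : Fin n) :
      Dominated (reciprocalQuadratic (x k)) ((1 + X) ^ 2) :=
    dominated_reciprocalQuadratic ((norm_le_pi_norm x k).trans (mem_closedBall_zero_iff.1 hx))
  have hdiff (k : Fin n) : Dominated (reciprocalQuadratic (y k) - reciprocalQuadratic (y' k))
      (C (dist y y' / 2) * (1 + X) ^ 2) := fun j => by
    refine (dominated_reciprocalQuadratic_sub _ _ j).trans ?_
    rw [coeff_C_mul, coeff_C_mul, coeff_one_add_X_pow]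
    gcongr
    exact dist_le_pi_dist y y' k
  refine (dist_pi_le_iff (by positivity)).2 fun i => ?_
  have h := Dominated.prod_sub_prod Finset.univ (hbound hy) (hbound hy') hdiff (i + 1)
  rw [Finset.prod_const, Finset.card_univ, Fintype.card_fin, coeff_sub, coeff_C_mul, ← pow_mul,
    coeff_one_add_X_pow] at h
  calc dist (coeffMap n y i) (coeffMap n y' i)
      ≤ n * (dist y y' / 2) * (2 * n).choose (i + 1) := h
    _ ≤ n * (dist y y' / 2) * n.centralBinom := by
        gcongr
        exact Nat.choose_le_centralBinom _ _
    _ = _ := by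
        push_cast
        ring

theorem two_mul_centralBinom_succ_le (m : ℕ) : 2 * (m + 1).centralBinom ≤ 4 ^ (m + 1) := by
  have hle : (2 * m + 1).choose m ≤ ∑ i ∈ Finset.range (m + 1), (2 * m + 1).choose i :=
    Finset.single_le_sum (f := (2 * m + 1).choose) (fun _ _ => Nat.zero_le _)
      (Finset.self_mem_range_succ m)
  have hsymm : (m + 1).centralBinom = 2 * (2 * m + 1).choose m := by
    rw [Nat.centralBinom, mul_add_one, Nat.choose_succ_succ', Nat.choose_symm_half, ← two_mul]
  have hsum := Nat.sum_range_choose_halfway m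
  rw [hsymm, pow_succ]
  lia

theorem isCompact_V {n : ℕ} (hn : n ≠ 0) : IsCompact (V n) := by
  rw [V_eq_image hn]
  exact (isCompact_closedBall _ _).image_of_continuousOn (lipschitzOnWith_coeffMap n).continuousOn

theorem eventually_exists_mem_eq_zero_of_sign {α : Type*} [TopologicalSpace α] {F : α → ℝ → ℝ}
    {a : α} {x₀ : ℝ} {s : Set ℝ} (hcont : ∀ b, Continuous (F b))
    (hF : ∀ x, ContinuousAt (F · x) a) (hs : s ∈ 𝓝 x₀)
    (hsign : ∀ᶠ x in 𝓝 x₀, SignType.sign (F a x) = SignType.sign (x - x₀)) :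
    ∀ᶠ b in 𝓝 a, ∃ x ∈ s, F b x = 0 := by
  obtain ⟨u, v, -, hnhds, hsub⟩ := exists_Icc_mem_subset_of_mem_nhds (inter_mem hs hsign)
  obtain ⟨hu, hv⟩ := Icc_mem_nhds_iff.1 hnhds
  have huv := (hu.trans hv).le
  have hFu : F a u < 0 := by
    rw [← sign_eq_neg_one_iff, (hsub (Set.left_mem_Icc.2 huv)).2, sign_eq_neg_one_iff, sub_neg]
    exact hu
  have hFv : 0 < F a v := by
    rw [← sign_eq_one_iff, (hsub (Set.right_mem_Icc.2 huv)).2, sign_eq_one_iff, sub_pos]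
    exact hv
  filter_upwards [(hF u).eventually_lt_const hFu, (hF v).eventually_const_lt hFv] with b hbu hbv
  obtain ⟨x, hx, hx0⟩ := intermediate_value_Icc huv (hcont b).continuousOn ⟨hbu.le, hbv.le⟩
  exact ⟨x, (hsub hx).1, hx0⟩

theorem eventually_exists_mem_eq_zero_of_deriv_ne_zero {α : Type*} [TopologicalSpace α]
    {F : α → ℝ → ℝ} {a : α} {x₀ : ℝ} {s : Set ℝ} (hcont : ∀ b, Continuous (F b))
    (hF : ∀ x, ContinuousAt (F · x) a) (hs : s ∈ 𝓝 x₀) (hzero : F a x₀ = 0)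
    (hderiv : deriv (F a) x₀ ≠ 0) : ∀ᶠ b in 𝓝 a, ∃ x ∈ s, F b x = 0 := by
  rcases hderiv.lt_or_gt with hneg | hpos
  · have hsign := eventually_nhdsWithin_sign_eq_of_deriv_pos (f := -F a) (x₀ := x₀)
      (by simpa [deriv.neg]) (by simpa)
    simpa using eventually_exists_mem_eq_zero_of_sign (F := fun b => -F b)
      (fun b => (hcont b).neg) (fun x => (hF x).neg) hs hsign
  · exact eventually_exists_mem_eq_zero_of_sign hcont hF hs
      (eventually_nhdsWithin_sign_eq_of_deriv_pos hpos hzero)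

theorem eq_nodal_of_eval_eq_zero {R ι : Type*} [CommRing R] [IsDomain R] [Fintype ι] {f : R[X]}
    (hf : f.Monic) (hdeg : f.natDegree = Fintype.card ι) {x : ι → R} (hx : Function.Injective x)
    (hzero : ∀ k, f.eval (x k) = 0) : f = nodal Finset.univ x := by
  classical
  refine eq_of_degree_sub_lt_of_eval_index_eq (s := Finset.univ) (v := x) hx.injOn ?_ fun k hk => ?_
  · rw [Finset.card_univ, ← hdeg, ← degree_eq_natDegree hf.ne_zero]
    refine degree_sub_lt_left ?_ hf.ne_zero ?_
    · rw [degree_nodal, degree_eq_natDegree hf.ne_zero, hdeg, Finset.card_univ]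
    · rw [hf.leadingCoeff, nodal_monic.leadingCoeff]
  · rw [hzero, eval_nodal_at_node hk]

theorem eval_derivative_nodal_ne_zero {R ι : Type*} [CommRing R] [IsDomain R] [Fintype ι]
    {y : ι → R} (hy : Function.Injective y) (k : ι) :
    (derivative (nodal Finset.univ y)).eval (y k) ≠ 0 := by
  classical
  rw [eval_nodal_derivative_eval_node_eq (Finset.mem_univ k)]
  exact eval_nodal_not_at_node fun j hj => hy.ne (Finset.ne_of_mem_erase hj).symm

theorem eventually_eq_nodal {α ι : Type*} [TopologicalSpace α] [Fintype ι] {f : α → ℝ[X]} {a : α}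
    (hf : ∀ b, (f b).Monic) (hdeg : ∀ b, (f b).natDegree = Fintype.card ι)
    (hcont : ∀ x, ContinuousAt (fun b => (f b).eval x) a) {y : ι → ℝ} (hy : Function.Injective y)
    (hfa : f a = nodal Finset.univ y) {s : Set ℝ} (hs : ∀ k, s ∈ 𝓝 (y k)) :
    ∀ᶠ b in 𝓝 a, ∃ x : ι → ℝ, (∀ k, x k ∈ s) ∧ f b = nodal Finset.univ x := by
  obtain ⟨U, hU, hdisj⟩ := (Set.finite_range y).t2_separation
  have hroot (k : ι) : ∀ᶠ b in 𝓝 a, ∃ x ∈ s ∩ U (y k), (f b).eval x = 0 := by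
    refine eventually_exists_mem_eq_zero_of_deriv_ne_zero (x₀ := y k) (fun b => (f b).continuous)
      hcont (inter_mem (hs k) ((hU _).2.mem_nhds (hU _).1)) ?_ ?_
    · rw [hfa, eval_nodal_at_node (Finset.mem_univ k)]
    · rw [Polynomial.deriv, hfa]
      exact eval_derivative_nodal_ne_zero hy k
  filter_upwards [eventually_all.2 hroot] with b hb
  choose x hx hzero using hb
  refine ⟨x, fun k => (hx k).1, eq_nodal_of_eval_eq_zero (hf b) (hdeg b) (fun k l hkl => ?_) hzero⟩
  exact hy (hdisj.elim_set ⟨k, rfl⟩ ⟨l, rfl⟩ (x k) (hx k).2 (hkl ▸ (hx l).2))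

theorem mem_interior_V {n : ℕ} (hn : n ≠ 0) {b y : Fin n → ℝ} (hy : ∀ k, |y k| < 2)
    (hinj : Function.Injective y) (h : tracePoly n b = nodal Finset.univ y) :
    b ∈ interior (V n) := by
  have hnodal := eventually_eq_nodal (s := closedBall 0 2) (monic_tracePoly hn)
    (fun b => by rw [natDegree_tracePoly hn, Fintype.card_fin])
    (fun x => (continuous_eval_tracePoly n x).continuousAt) hinj h
    fun k => closedBall_mem_nhds_of_mem (mem_ball_zero_iff.2 (hy k))
  rw [mem_interior_iff_mem_nhds]
  filter_upwards [hnodal] with b' ⟨x, hx, hb'⟩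
  rw [eq_coeffMap hb']
  refine coeffMap_mem_V hn ?_
  rw [closedBall_pi _ zero_le_two]
  exact fun k _ => hx k

/-- The three ways to choose an extra root that makes a system of roots `w` in `[-2, 2]` degenerate:
the endpoint `2`, the endpoint `-2`, or the first entry of `w` (the dummy value `0` if there is
none). -/
noncomputable def extraRoot {m : ℕ} (j : Fin 3) (w : Fin m → ℝ) : ℝ :=
  match j with
  | 0 => 2
  | 1 => -2
  | 2 => if h : 0 < m then w ⟨0, h⟩ else 0

/-- The degenerate system of `m + 1` roots obtained from `m` roots by prepending the `j`-th kind of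
`extraRoot`. -/
noncomputable def degenerateRoots {m : ℕ} (j : Fin 3) (w : Fin m → ℝ) : Fin (m + 1) → ℝ :=
  Fin.cons (extraRoot j w) w

theorem lipschitzWith_extraRoot {m : ℕ} (j : Fin 3) :
    LipschitzWith 1 (extraRoot j : (Fin m → ℝ) → ℝ) := by
  refine LipschitzWith.mk_one fun w w' => ?_
  match j with
  | 0 => simp [extraRoot]
  | 1 => simp [extraRoot]
  | 2 =>
    rw [extraRoot, extraRoot]
    split_ifs
    · exact dist_le_pi_dist w w' _
    · simp

theorem lipschitzWith_degenerateRoots {m : ℕ} (j : Fin 3) :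
    LipschitzWith 1 (degenerateRoots j : (Fin m → ℝ) → Fin (m + 1) → ℝ) :=
  LipschitzWith.mk_one fun w w' => (dist_pi_le_iff dist_nonneg).2 <|
    Fin.cases (by simpa using! (lipschitzWith_extraRoot j).dist_le_mul w w')
      (dist_le_pi_dist w w')

theorem abs_extraRoot_le {m : ℕ} (j : Fin 3) {w : Fin m → ℝ} (hw : w ∈ closedBall 0 2) :
    |extraRoot j w| ≤ 2 := by
  match j with
  | 0 => simp [extraRoot]
  | 1 => simp [extraRoot]
  | 2 =>
    rw [extraRoot]
    split_ifs
    · exact (norm_le_pi_norm w _).trans (mem_closedBall_zero_iff.1 hw)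
    · simp

theorem degenerateRoots_mem_closedBall {m : ℕ} (j : Fin 3) {w : Fin m → ℝ}
    (hw : w ∈ closedBall 0 2) : degenerateRoots j w ∈ closedBall 0 2 := by
  rw [mem_closedBall_zero_iff, pi_norm_le_iff_of_nonneg zero_le_two]
  refine Fin.cases (abs_extraRoot_le j hw) fun k => ?_
  exact (norm_le_pi_norm w k).trans (mem_closedBall_zero_iff.1 hw)

theorem exists_perm_eq_degenerateRoots {m : ℕ} {y : Fin (m + 1) → ℝ}
    (h : (∃ k, |y k| = 2) ∨ ¬ Function.Injective y) :
    ∃ (σ : Equiv.Perm (Fin (m + 1))) (j : Fin 3),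
      y ∘ σ = degenerateRoots j (Fin.tail (y ∘ σ)) := by
  suffices ∃ (σ : Equiv.Perm (Fin (m + 1))) (j : Fin 3),
      extraRoot j (Fin.tail (y ∘ σ)) = y (σ 0) by
    obtain ⟨σ, j, hj⟩ := this
    refine ⟨σ, j, ?_⟩
    rw [degenerateRoots, hj]
    exact (Fin.cons_self_tail (y ∘ σ)).symm
  rcases h with ⟨k, hk⟩ | hinj
  · rcases (abs_eq zero_le_two).1 hk with hk | hk
    · exact ⟨Equiv.swap 0 k, 0, by rw [Equiv.swap_apply_left, hk]; rfl⟩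
    · exact ⟨Equiv.swap 0 k, 1, by rw [Equiv.swap_apply_left, hk]; rfl⟩
  · obtain ⟨k, l, hkl, hne⟩ := Function.not_injective_iff.1 hinj
    have hm : 0 < m := by
      by_contra! hm
      exact hne (Fin.ext (by lia))
    obtain ⟨σ, hk, hl⟩ := MulAction.is_two_pretransitive_iff.1
      (Equiv.Perm.isMultiplyPretransitive (Fin (m + 1)) 2)
      (Fin.succ_ne_zero (⟨0, hm⟩ : Fin m)).symm hne
    rw [Equiv.Perm.smul_def] at hk hl
    refine ⟨σ, 2, ?_⟩
    rw [extraRoot, dif_pos hm, Fin.tail, Function.comp_apply, hl, hk, hkl]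

theorem frontier_V_subset (m : ℕ) : frontier (V (m + 1)) ⊆
    ⋃ j, (coeffMap (m + 1) ∘ degenerateRoots j) '' closedBall 0 2 := by
  intro b hb
  have hm := m.succ_ne_zero
  obtain ⟨y, hy, h⟩ := exists_tracePoly_eq_nodal hm ((isCompact_V hm).isClosed.frontier_subset hb)
  have hle (k : Fin (m + 1)) : |y k| ≤ 2 :=
    (norm_le_pi_norm y k).trans (mem_closedBall_zero_iff.1 hy)
  have hdegenerate : (∃ k, |y k| = 2) ∨ ¬ Function.Injective y := by
    by_contra! hregular
    exact hb.2 (mem_interior_V hm (fun k => (hle k).lt_of_ne (hregular.1 k)) hregular.2 h)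
  obtain ⟨σ, j, hσ⟩ := exists_perm_eq_degenerateRoots hdegenerate
  refine Set.mem_iUnion.2 ⟨j, Fin.tail (y ∘ σ), ?_, ?_⟩
  · rw [mem_closedBall_zero_iff, pi_norm_le_iff_of_nonneg zero_le_two]
    exact fun k => hle _
  · rw [Function.comp_apply, ← hσ, coeffMap_comp_perm, eq_coeffMap h]

theorem exists_fin_le_le_add_one {M : ℕ} [NeZero M] {t : ℝ} (h₀ : 0 ≤ t) (hM : t ≤ M) :
    ∃ k : Fin M, (k : ℝ) ≤ t ∧ t ≤ k + 1 := by
  rcases h₀.eq_or_lt with rfl | ht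
  · exact ⟨0, by simp, by simp⟩
  · have hceil : ⌈t⌉₊ - 1 + 1 = ⌈t⌉₊ := Nat.sub_add_cancel (Nat.ceil_pos.2 ht)
    refine ⟨⟨⌈t⌉₊ - 1, by have := Nat.ceil_le.2 hM; lia⟩, (Nat.lt_ceil.1 (by lia)).le, ?_⟩
    exact_mod_cast (Nat.le_ceil t).trans_eq (by rw [hceil])

theorem exists_closedBall_subset_iUnion_closedBall_real (M : ℕ) [NeZero M] {r : ℝ} (hr : 0 < r) :
    ∃ c : Fin M → ℝ, (∀ k, c k ∈ closedBall 0 r) ∧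
      closedBall 0 r ⊆ ⋃ k, closedBall (c k) (r / M) := by
  have hM : (0 : ℝ) < M := Nat.cast_pos.2 (NeZero.pos M)
  refine ⟨fun k => (2 * k + 1 - M) * (r / M), fun k => ?_, fun x hx => ?_⟩
  · have hk : (k : ℝ) + 1 ≤ M := by exact_mod_cast k.2
    have hle : |2 * (k : ℝ) + 1 - M| ≤ M := abs_le.2 ⟨by linarith, by linarith⟩
    rw [mem_closedBall_zero_iff, norm_mul, Real.norm_of_nonneg (by positivity : 0 ≤ r / M)]
    calc |2 * (k : ℝ) + 1 - M| * (r / M) ≤ M * (r / M) := by gcongr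
      _ = r := mul_div_cancel₀ r hM.ne'
  · obtain ⟨hxl, hxr⟩ := abs_le.1 (mem_closedBall_zero_iff.1 hx)
    set t : ℝ := (x + r) / (2 * (r / M)) with ht
    have hxt : x = (2 * t - M) * (r / M) := by rw [ht]; field_simp; ring
    obtain ⟨k, hkt, htk⟩ := exists_fin_le_le_add_one (M := M) (t := t)
      (div_nonneg (by linarith) (by positivity)) (by
        rw [ht, div_le_iff₀ (by positivity)]
        field_simp
        linarith)
    have hle : |2 * t - M - (2 * k + 1 - M)| ≤ 1 := abs_le.2 ⟨by linarith, by linarith⟩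
    refine Set.mem_iUnion.2 ⟨k, ?_⟩
    rw [mem_closedBall, Real.dist_eq, hxt, ← sub_mul, abs_mul,
      abs_of_nonneg (by positivity : 0 ≤ r / M)]
    exact mul_le_of_le_one_left (by positivity) hle

theorem exists_closedBall_subset_iUnion_closedBall (ι : Type*) [Fintype ι] (M : ℕ) [NeZero M]
    {r : ℝ} (hr : 0 < r) :
    ∃ c : (ι → Fin M) → ι → ℝ, (∀ κ, c κ ∈ closedBall 0 r) ∧
      closedBall 0 r ⊆ ⋃ κ, closedBall (c κ) (r / M) := by
  obtain ⟨c, hc, hcover⟩ := exists_closedBall_subset_iUnion_closedBall_real M hr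
  refine ⟨fun κ i => c (κ i), fun κ => ?_, fun x hx => ?_⟩
  · rw [closedBall_pi _ hr.le]
    exact fun i _ => hc (κ i)
  · rw [closedBall_pi _ hr.le] at hx
    choose κ hκ using fun i => Set.mem_iUnion.1 (hcover (hx i trivial))
    refine Set.mem_iUnion.2 ⟨κ, ?_⟩
    rw [closedBall_pi _ (by positivity)]
    exact fun i _ => hκ i

theorem exists_image_subset_iUnion_closedBall {ι α : Type*} [Fintype ι]
    [PseudoMetricSpace α] (M : ℕ) [NeZero M] {r : ℝ} (hr : 0 < r) {K : ℝ≥0} {φ : (ι → ℝ) → α}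
    (hφ : LipschitzOnWith K φ (closedBall 0 r)) :
    ∃ c : (ι → Fin M) → α, φ '' closedBall 0 r ⊆ ⋃ κ, closedBall (c κ) (K * (r / M)) := by
  obtain ⟨c, hc, hcover⟩ := exists_closedBall_subset_iUnion_closedBall ι M hr
  refine ⟨φ ∘ c, ?_⟩
  rintro _ ⟨x, hx, rfl⟩
  obtain ⟨κ, hκ⟩ := Set.mem_iUnion.1 (hcover hx)
  refine Set.mem_iUnion.2 ⟨κ, (hφ.dist_le_mul x hx _ (hc κ)).trans ?_⟩
  gcongr
  exact hκ

theorem volume_cthickening_le_of_subset_iUnion_closedBall {ι κ : Type*} [Fintype ι] [Fintype κ]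
    {A : Set (ι → ℝ)} (hA : IsCompact A) {c : κ → ι → ℝ} {r d : ℝ} (hr : 0 ≤ r) (hd : 0 ≤ d)
    (hAc : A ⊆ ⋃ k, closedBall (c k) r) :
    volume (cthickening d A) ≤
      ENNReal.ofReal (Fintype.card κ * (2 * (d + r)) ^ Fintype.card ι) := by
  have hsub : cthickening d A ⊆ ⋃ k, closedBall (c k) (d + r) := by
    rw [hA.cthickening_eq_biUnion_closedBall hd]
    refine Set.iUnion₂_subset fun a ha x hx => ?_
    obtain ⟨k, hk⟩ := Set.mem_iUnion.1 (hAc ha)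
    exact Set.mem_iUnion.2 ⟨k, (dist_triangle x a (c k)).trans (add_le_add hx hk)⟩
  calc volume (cthickening d A) ≤ ∑ k, volume (closedBall (c k) (d + r)) :=
        (measure_mono hsub).trans (measure_iUnion_fintype_le _ _)
    _ = ENNReal.ofReal (Fintype.card κ * (2 * (d + r)) ^ Fintype.card ι) := by
        simp only [Real.volume_pi_closedBall _ (add_nonneg hd hr), Finset.sum_const,
          Finset.card_univ, nsmul_eq_mul]
        rw [ENNReal.ofReal_mul (Nat.cast_nonneg _), ENNReal.ofReal_natCast]

theorem exists_frontier_V_subset_iUnion_closedBall (m M : ℕ) [NeZero M] :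
    ∃ c : Fin 3 × (Fin m → Fin M) → Fin (m + 1) → ℝ,
      frontier (V (m + 1)) ⊆ ⋃ t, closedBall (c t) ((m + 1) * (2 * 4 ^ m / M)) := by
  have hlipschitz (j : Fin 3) : LipschitzOnWith ((m + 1 : ℕ) * (m + 1).centralBinom / 2)
      (coeffMap (m + 1) ∘ degenerateRoots j) (closedBall 0 2) := by
    simpa using (lipschitzOnWith_coeffMap (m + 1)).comp
      (lipschitzWith_degenerateRoots j).lipschitzOnWith
      fun w hw => degenerateRoots_mem_closedBall j hw
  choose c hc using fun j => exists_image_subset_iUnion_closedBall M two_pos (hlipschitz j)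
  have hbinom : ((m + 1).centralBinom : ℝ) ≤ 2 * 4 ^ m := by
    have hle : (2 * (m + 1).centralBinom : ℝ) ≤ 4 ^ (m + 1) := by
      exact_mod_cast two_mul_centralBinom_succ_le m
    linarith [pow_succ (4 : ℝ) m]
  refine ⟨fun t => c t.1 t.2, (frontier_V_subset m).trans (Set.iUnion_subset fun j x hx => ?_)⟩
  obtain ⟨κ, hκ⟩ := Set.mem_iUnion.1 (hc j hx)
  refine Set.mem_iUnion.2 ⟨(j, κ), closedBall_subset_closedBall ?_ hκ⟩
  calc (((m + 1 : ℕ) * (m + 1).centralBinom / 2 : ℝ≥0) : ℝ) * (2 / M)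
      = (m + 1) * ((m + 1).centralBinom / M) := by push_cast; ring
    _ ≤ (m + 1) * (2 * 4 ^ m / M) := by gcongr

theorem volume_cthickening_frontier_V_le (m : ℕ) {d : ℝ} (hd₀ : 0 < d) (hd₁ : d ≤ 1) :
    volume (cthickening d (frontier (V (m + 1)))) ≤
      ENNReal.ofReal (3 * (2 * 4 ^ m + 1) ^ m * (2 * (m + 2)) ^ (m + 1) * d) := by
  set M : ℕ := ⌈(2 * 4 ^ m : ℝ) / d⌉₊
  have hM : 0 < M := Nat.ceil_pos.2 (by positivity)
  have hceil : (M : ℝ) < 2 * 4 ^ m / d + 1 := Nat.ceil_lt_add_one (by positivity)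
  have hmesh : 2 * 4 ^ m / M ≤ d := by
    rw [div_le_comm₀ (Nat.cast_pos.2 hM) hd₀]
    exact Nat.le_ceil _
  have hMd : M * d ≤ 2 * 4 ^ m + 1 :=
    calc M * d ≤ (2 * 4 ^ m / d + 1) * d := by gcongr
      _ = 2 * 4 ^ m + d := by field_simp
      _ ≤ 2 * 4 ^ m + 1 := by gcongr
  have : NeZero M := ⟨hM.ne'⟩
  obtain ⟨c, hc⟩ := exists_frontier_V_subset_iUnion_closedBall m M
  have hcompact : IsCompact (frontier (V (m + 1))) :=
    (isCompact_V m.succ_ne_zero).of_isClosed_subset isClosed_frontier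
      (isCompact_V m.succ_ne_zero).isClosed.frontier_subset
  refine (volume_cthickening_le_of_subset_iUnion_closedBall hcompact (by positivity) hd₀.le
    hc).trans (ENNReal.ofReal_le_ofReal ?_)
  simp only [Fintype.card_prod, Fintype.card_fun, Fintype.card_fin, Nat.cast_mul, Nat.cast_pow,
    Nat.cast_ofNat]
  calc 3 * (M : ℝ) ^ m * (2 * (d + (m + 1) * (2 * 4 ^ m / M))) ^ (m + 1)
      ≤ 3 * (M : ℝ) ^ m * (2 * (d + (m + 1) * d)) ^ (m + 1) := by gcongr
    _ = 3 * (M * d) ^ m * (2 * (m + 2)) ^ (m + 1) * d := by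
        rw [show 2 * (d + (m + 1) * d) = 2 * (m + 2) * d by ring, mul_pow _ d, mul_pow _ d,
          pow_succ d]
        ring
    _ ≤ 3 * (2 * 4 ^ m + 1) ^ m * (2 * (m + 2)) ^ (m + 1) * d := by gcongr

theorem inter_frontier_nonempty_of_isPreconnected {X : Type*} [TopologicalSpace X] {s t : Set X}
    (ht : IsPreconnected t) {x y : X} (hxt : x ∈ t) (hxs : x ∈ s) (hyt : y ∈ t) (hys : y ∉ s) :
    (t ∩ frontier s).Nonempty := by
  have : PreconnectedSpace t := isPreconnected_iff_preconnectedSpace.1 ht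
  obtain ⟨z, hz⟩ := nonempty_frontier_iff (s := ((↑) : t → X) ⁻¹' s) |>.2
    ⟨⟨⟨x, hxt⟩, hxs⟩, Set.ne_univ_iff_exists_notMem _ |>.2 ⟨⟨y, hyt⟩, hys⟩⟩
  exact ⟨z, z.2, continuous_subtype_val.frontier_preimage_subset s hz⟩

theorem mem_cthickening_frontier_of_dist_le {E : Type*} [SeminormedAddCommGroup E] [NormedSpace ℝ E]
    {s : Set E} {x y : E} {d : ℝ} (hxy : dist x y ≤ d) (h : ¬ (x ∈ s ↔ y ∈ s)) :
    x ∈ cthickening d (frontier s) := by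
  have hsegment : IsPreconnected (segment ℝ x y) := (convex_segment x y).isPreconnected
  obtain ⟨z, hz, hzs⟩ : (segment ℝ x y ∩ frontier s).Nonempty := by
    by_cases hx : x ∈ s
    · exact inter_frontier_nonempty_of_isPreconnected hsegment (left_mem_segment ℝ x y) hx
        (right_mem_segment ℝ x y) (by tauto)
    · exact inter_frontier_nonempty_of_isPreconnected hsegment (right_mem_segment ℝ x y)
        (by tauto) (left_mem_segment ℝ x y) hx
  refine mem_cthickening_of_dist_le x z d _ hzs (le_trans ?_ hxy)
  linarith [dist_add_dist_of_mem_segment hz, dist_nonneg (x := z) (y := y)]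

theorem finite_inter_of_isBounded {E : Type*} [NormedAddCommGroup E] [ProperSpace E]
    (Λ : Submodule ℤ E) [DiscreteTopology Λ] {s : Set E} (hs : Bornology.IsBounded s) :
    ((Λ : Set E) ∩ s).Finite := by
  rw [Set.inter_comm]
  exact finite_isBounded_inter_isClosed ⟨inferInstanceAs (DiscreteTopology Λ)⟩ hs
    (AddSubgroup.isClosed_of_discrete (H := Λ.toAddSubgroup))

theorem measureReal_biUnion_vadd {G α : Type*} [AddGroup G] [AddAction G α] [MeasurableSpace α]
    {μ : Measure α} [MeasurableConstVAdd G α] [VAddInvariantMeasure G α μ] {F : Set α}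
    (hF : IsAddFundamentalDomain G F μ) {T : Set G} (hT : T.Finite) :
    μ.real (⋃ g ∈ T, g +ᵥ F) = T.ncard * μ.real F := by
  lift T to Finset G using hT
  have hμ : μ (⋃ g ∈ T, g +ᵥ F) = ∑ g ∈ T, μ (g +ᵥ F) :=
    measure_biUnion_finset₀ (fun g _ g' _ hne => hF.aedisjoint hne)
      fun g _ => hF.nullMeasurableSet_vadd g
  simp [measureReal_def, hμ]

theorem symmDiff_biUnion_vadd_ae_le {E : Type*} [NormedAddCommGroup E] [NormedSpace ℝ E]
    [MeasurableSpace E] {μ : Measure E} {Λ : Submodule ℤ E} {F : Set E} {d : ℝ}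
    (hF : IsAddFundamentalDomain Λ F μ) (hFd : F ⊆ closedBall 0 d) (s : Set E) :
    (symmDiff (⋃ l ∈ {l : Λ | (l : E) ∈ s}, l +ᵥ F) s : Set E) ≤ᵐ[μ]
      cthickening d (frontier s) := by
  have hdist {l : Λ} {x : E} (hx : x ∈ l +ᵥ F) : dist x l ≤ d := by
    obtain ⟨u, hu, rfl⟩ := hx
    simpa [Submodule.vadd_def] using hFd hu
  filter_upwards [hF.ae_covers] with x ⟨l, hl⟩ hx
  rcases hx with ⟨hx, hxs⟩ | ⟨hxs, hx⟩
  · obtain ⟨l, hls, hxl⟩ := Set.mem_iUnion₂.1 hx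
    exact mem_cthickening_frontier_of_dist_le (hdist hxl) fun h => hxs (h.2 hls)
  · have hxl : x ∈ -l +ᵥ F := ⟨l +ᵥ x, hl, neg_vadd_vadd l x⟩
    exact mem_cthickening_frontier_of_dist_le (hdist hxl) fun h =>
      hx (Set.mem_biUnion (h.1 hxs) hxl)

theorem abs_ncard_mul_covolume_sub_le {E : Type*} [NormedAddCommGroup E] [NormedSpace ℝ E]
    [FiniteDimensional ℝ E] [MeasurableSpace E] [BorelSpace E] {μ : Measure E}
    [μ.IsAddHaarMeasure] {Λ : Submodule ℤ E} [DiscreteTopology Λ] [IsZLattice ℝ Λ] {F s : Set E}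
    {d : ℝ} (hF : IsAddFundamentalDomain Λ F μ) (hFd : F ⊆ closedBall 0 d)
    (hs : NullMeasurableSet s μ) (hbounded : Bornology.IsBounded s) :
    |((Λ : Set E) ∩ s).ncard * ZLattice.covolume Λ μ - μ.real s| ≤
      μ.real (cthickening d (frontier s)) := by
  have : ProperSpace E := FiniteDimensional.proper ℝ E
  have : MeasurableVAdd Λ E := inferInstanceAs (MeasurableVAdd Λ.toAddSubgroup E)
  have : VAddInvariantMeasure Λ E μ :=
    inferInstanceAs (VAddInvariantMeasure Λ.toAddSubgroup E μ)
  have : Countable Λ := countable_of_Lindelof_of_discrete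
  set T : Set Λ := {l | (l : E) ∈ s} with hT
  have hcard : ((Λ : Set E) ∩ s).ncard = T.ncard := by
    rw [Set.inter_comm, hT]
    exact (Set.ncard_subtype (· ∈ Λ) s).symm
  have hfinite : T.Finite :=
    ((finite_inter_of_isBounded Λ hbounded).preimage Subtype.val_injective.injOn).subset
      fun l hl => ⟨l.2, hl⟩
  have htiles : NullMeasurableSet (⋃ l ∈ T, l +ᵥ F) μ :=
    .biUnion T.to_countable fun l _ => hF.nullMeasurableSet_vadd l
  have htiles_bounded : Bornology.IsBounded (⋃ l ∈ T, l +ᵥ F) :=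
    (Bornology.isBounded_biUnion hfinite).2 fun l _ =>
      (isBounded_closedBall.subset hFd).vadd (l : E)
  rw [hcard, ZLattice.covolume_eq_measure_fundamentalDomain Λ μ hF,
    ← measureReal_biUnion_vadd hF hfinite]
  refine (abs_measureReal_sub_le_measureReal_symmDiff' htiles hs htiles_bounded.measure_lt_top.ne
    hbounded.measure_lt_top.ne).trans ?_
  exact ENNReal.toReal_mono
    (hbounded.closure.subset frontier_subset_closure).cthickening.measure_lt_top.ne
    (measure_mono_ae (symmDiff_biUnion_vadd_ae_le hF hFd s))

theorem le_mesh {n : ℕ} (p q : Fin n → ℝ) (i : Fin n) : q i - p i ≤ mesh p q :=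
  le_ciSup (f := fun i => q i - p i) (Set.finite_range _).bddAbove i

theorem neg_vadd_box_subset_closedBall {n : ℕ} {p q : Fin n → ℝ} (hd : 0 ≤ mesh p q) :
    -p +ᵥ box p q ⊆ closedBall 0 (mesh p q) := by
  rintro _ ⟨u, hu, rfl⟩
  rw [mem_closedBall_zero_iff, pi_norm_le_iff_of_nonneg hd]
  intro i
  obtain ⟨hpu, huq⟩ := hu i trivial
  have hle := le_mesh p q i
  change |-p i + u i| ≤ mesh p q
  rw [abs_le]
  constructor <;> linarith

theorem IsRectilinearDomain.isAddFundamentalDomain_neg_vadd_box {n : ℕ}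
    {Λ : Submodule ℤ (Fin n → ℝ)} {p q : Fin n → ℝ} (h : IsRectilinearDomain Λ p q) :
    IsAddFundamentalDomain Λ (-p +ᵥ box p q) volume := by
  have : VAddCommClass (Fin n → ℝ) Λ (Fin n → ℝ) :=
    ⟨fun a b c => vadd_comm a (b : Fin n → ℝ) c⟩
  exact h.isAddFundamentalDomain.vadd_of_comm (-p)

theorem two_pow_mul_factorial_le (m : ℕ) : 2 ^ m * m.factorial ≤ (m + 1) ^ m := by
  induction m with
  | zero => simp
  | succ m ih =>
    calc 2 ^ (m + 1) * (m + 1).factorial = 2 * (m + 1) * (2 ^ m * m.factorial) := by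
          rw [Nat.factorial_succ]; ring
      _ ≤ 2 * (m + 1) * (m + 1) ^ m := by gcongr
      _ = (m + 1) ^ (m + 1) + (m + 1) * (m + 1) ^ m * 1 := by ring
      _ ≤ (m + 1 + 1) ^ (m + 1) :=
          pow_add_mul_le_add_pow (Nat.zero_le _) (Nat.zero_le _) (m + 1)

theorem add_one_pow_le {a : ℝ} {m : ℕ} (h : 8 * m ≤ a) : (a + 1) ^ m ≤ 8 / 7 * a ^ m := by
  have ha : 0 < a + 1 := by linarith [m.cast_nonneg (α := ℝ)]
  have hbernoulli := one_add_mul_le_pow (a := -(a + 1)⁻¹)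
    (by linarith [inv_le_one_of_one_le₀ (by linarith [m.cast_nonneg (α := ℝ)] : 1 ≤ a + 1)]) m
  have heq : 1 + -(a + 1)⁻¹ = a / (a + 1) := by field_simp; ring
  have hle : m * (a + 1)⁻¹ ≤ 1 / 8 := by
    rw [← div_eq_mul_inv, div_le_iff₀ ha]
    linarith
  have hratio : 7 / 8 ≤ a ^ m / (a + 1) ^ m := by
    rw [← div_pow, ← heq]
    linarith
  rw [le_div_iff₀ (by positivity)] at hratio
  linarith

theorem four_mul_le_four_pow (m : ℕ) : 4 * m ≤ 4 ^ m := by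
  cases m with
  | zero => simp
  | succ m => rw [pow_succ']; exact Nat.mul_le_mul_left 4 (Nat.lt_pow_self (by norm_num))

theorem succ_mul_add_two_div_two_le {m : ℕ} (hm : 6 ≤ m) :
    ((m : ℝ) + 1) * (m + 2) / 2 ≤ 1.15 * 1.5 ^ (m + 2) := by
  induction m, hm using Nat.le_induction with
  | base => norm_num
  | succ m hm ih =>
    have hm' : (6 : ℝ) ≤ m := by exact_mod_cast hm
    rw [show m + 1 + 2 = m + 2 + 1 from rfl, pow_succ]
    push_cast
    nlinarith

theorem factorial_mul_pow_le (m : ℕ) :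
    48 / 7 * (m.factorial : ℝ) * (m + 2) ^ m ≤
      5 * (m + 1) * 1.15 ^ (m + 1) * 1.5 ^ ((m + 1) ^ 2) := by
  rcases lt_or_ge m 6 with hm | hm
  · interval_cases m <;> norm_num [Nat.factorial]
  have hm' : (6 : ℝ) ≤ m := by exact_mod_cast hm
  have hfactorial : (m.factorial : ℝ) ≤ ((m + 1) / 2) ^ m := by
    rw [div_pow, le_div_iff₀ (by positivity), mul_comm]
    exact_mod_cast two_pow_mul_factorial_le m
  calc 48 / 7 * (m.factorial : ℝ) * (m + 2) ^ m
      ≤ 48 / 7 * ((m + 1) / 2) ^ m * (m + 2) ^ m := by gcongr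
    _ = 48 / 7 * ((m + 1) * (m + 2) / 2) ^ m := by
        rw [mul_assoc, ← mul_pow]; ring
    _ ≤ 5 * (m + 1) * 1.15 * 1.5 * (1.15 * 1.5 ^ (m + 2)) ^ m := by
        gcongr
        · linarith
        · exact succ_mul_add_two_div_two_le hm
    _ = 5 * (m + 1) * 1.15 ^ (m + 1) * 1.5 ^ ((m + 1) ^ 2) := by
        rw [mul_pow, ← pow_mul]; ring

theorem five_le_c₃ : 5 ≤ c₃ := by
  have hsqrt : (1.73 : ℝ) ≤ √3 := Real.le_sqrt_of_sq_le (by norm_num)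
  have hexp : (4.35 : ℝ) ≤ Real.exp (3 / 2) :=
    calc (4.35 : ℝ) ≤ ∑ i ∈ Finset.range 5, (3 / 2 : ℝ) ^ i / i.factorial := by
          norm_num [Finset.sum_range_succ, Nat.factorial]
      _ ≤ Real.exp (3 / 2) := Real.sum_le_exp_of_nonneg (by norm_num) 5
  have heq : c₃ = Real.exp (3 / 2) * 2 * √3 * (1 + √3 / 162) ^ 3 / 3 := by
    rw [c₃, c₂]
    field_simp
  rw [heq]
  calc (5 : ℝ) ≤ 4.35 * 2 * 1.73 * (1 + 0 / 162) ^ 3 / 3 := by norm_num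
    _ ≤ Real.exp (3 / 2) * 2 * √3 * (1 + √3 / 162) ^ 3 / 3 := by gcongr; positivity

theorem le_four_mul_c₁ : 1.15 ≤ 4 * c₁ := by
  have hsqrt : (1.73 : ℝ) ≤ √3 := Real.le_sqrt_of_sq_le (by norm_num)
  rw [c₁]
  linarith

theorem covering_constant_le (m : ℕ) :
    3 * (2 * 4 ^ m + 1 : ℝ) ^ m * (2 * (m + 2)) ^ (m + 1) ≤
      6 ^ ((m + 1) ^ 2) * c₁ ^ (m + 1) * c₃ * (((m : ℝ) + 1) * (m + 1 + 1) / m.factorial) := by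
  rw [← mul_div_assoc, le_div_iff₀ (Nat.cast_pos.2 m.factorial_pos)]
  have hsix : (6 : ℝ) ^ ((m + 1) ^ 2) * c₁ ^ (m + 1) =
      4 ^ (m ^ 2) * 4 ^ m * ((4 * c₁) ^ (m + 1) * 1.5 ^ ((m + 1) ^ 2)) := by
    rw [show (6 : ℝ) = 4 * 1.5 by norm_num, mul_pow, mul_pow 4 c₁]
    ring
  have hfour : (2 * 4 ^ m : ℝ) ^ m * 2 ^ (m + 1) = 2 * (4 ^ (m ^ 2) * 4 ^ m) := by
    have h : (4 : ℝ) ^ m = 2 ^ m * 2 ^ m := by rw [← mul_pow]; norm_num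
    calc (2 * 4 ^ m : ℝ) ^ m * 2 ^ (m + 1) = 2 * (4 ^ (m ^ 2) * (2 ^ m * 2 ^ m)) := by ring
      _ = 2 * (4 ^ (m ^ 2) * 4 ^ m) := by rw [h]
  have hlarge : (8 * m : ℝ) ≤ 2 * 4 ^ m := by
    have h : (4 * m : ℝ) ≤ 4 ^ m := by exact_mod_cast four_mul_le_four_pow m
    linarith
  have hc₃ := five_le_c₃
  have hc₁ := le_four_mul_c₁
  calc 3 * (2 * 4 ^ m + 1 : ℝ) ^ m * (2 * (m + 2)) ^ (m + 1) * m.factorial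
      ≤ 3 * (8 / 7 * (2 * 4 ^ m) ^ m) * (2 * (m + 2)) ^ (m + 1) * m.factorial := by
        gcongr
        exact add_one_pow_le hlarge
    _ = 24 / 7 * ((2 * 4 ^ m) ^ m * 2 ^ (m + 1)) * (m + 2) ^ (m + 1) * m.factorial := by
        rw [mul_pow 2 ((m : ℝ) + 2)]; ring
    _ = 4 ^ (m ^ 2) * 4 ^ m * (m + 2) * (48 / 7 * m.factorial * (m + 2) ^ m) := by
        rw [hfour]; ring
    _ ≤ 4 ^ (m ^ 2) * 4 ^ m * (m + 2) *
        (5 * (m + 1) * 1.15 ^ (m + 1) * 1.5 ^ ((m + 1) ^ 2)) := by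
        gcongr ?_ * ?_
        exact factorial_mul_pow_le m
    _ ≤ 4 ^ (m ^ 2) * 4 ^ m * (m + 2) *
        (c₃ * (m + 1) * (4 * c₁) ^ (m + 1) * 1.5 ^ ((m + 1) ^ 2)) := by gcongr
    _ = 6 ^ ((m + 1) ^ 2) * c₁ ^ (m + 1) * c₃ * (((m : ℝ) + 1) * (m + 1 + 1)) := by
        rw [hsix]; ring

end UnitCirclePoly

theorem proposition2p3p1 (n : ℕ) (hn : 0 < n)
    (Λ : Submodule ℤ (Fin n → ℝ)) [DiscreteTopology Λ] [IsZLattice ℝ Λ]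
    (p q : Fin n → ℝ) (hΛ : UnitCirclePoly.IsRectilinearDomain Λ p q)
    (hd : UnitCirclePoly.mesh p q ≤ 1) :
    ((Λ : Set (Fin n → ℝ)) ∩ UnitCirclePoly.V n).Finite ∧
    MeasureTheory.volume (UnitCirclePoly.V n) ≠ ⊤ ∧
    |(((Λ : Set (Fin n → ℝ)) ∩ UnitCirclePoly.V n).ncard : ℝ) -
        (MeasureTheory.volume (UnitCirclePoly.V n)).toReal / ZLattice.covolume Λ| ≤
      6 ^ (n ^ 2) * UnitCirclePoly.c₁ ^ n * UnitCirclePoly.c₃ *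
        ((n : ℝ) * (n + 1) / (Nat.factorial (n - 1) : ℝ)) *
        (UnitCirclePoly.mesh p q / ZLattice.covolume Λ) := by
  obtain ⟨m, rfl⟩ : ∃ m, n = m + 1 := ⟨n - 1, by omega⟩
  have hV := UnitCirclePoly.isCompact_V m.succ_ne_zero
  have hmesh : 0 < UnitCirclePoly.mesh p q :=
    (sub_pos.2 (hΛ.lt 0)).trans_le (UnitCirclePoly.le_mesh p q 0)
  have hcovolume : 0 < ZLattice.covolume Λ := ZLattice.covolume_pos Λ
  refine ⟨UnitCirclePoly.finite_inter_of_isBounded Λ hV.isBounded, hV.measure_lt_top.ne, ?_⟩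
  have hcount := UnitCirclePoly.abs_ncard_mul_covolume_sub_le
    hΛ.isAddFundamentalDomain_neg_vadd_box
    (UnitCirclePoly.neg_vadd_box_subset_closedBall hmesh.le)
    hV.measurableSet.nullMeasurableSet hV.isBounded
  have hfrontier := ENNReal.toReal_le_of_le_ofReal (by positivity)
    (UnitCirclePoly.volume_cthickening_frontier_V_le m hmesh hd)
  have hconstant := UnitCirclePoly.covering_constant_le m
  rw [← mul_div_assoc, le_div_iff₀ hcovolume, ← abs_of_pos hcovolume, ← abs_mul,
    abs_of_pos hcovolume, sub_mul, div_mul_cancel₀ _ hcovolume.ne']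
  push_cast
  exact (hcount.trans hfrontier).trans (mul_le_mul_of_nonneg_right hconstant hmesh.le)
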